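/- Let $Z$ be a totally ordered set of letters, let $\mathbb{Q}Z$ be the $\mathbb{Q}$-vector space with basis $Z$, and let $\lozenge:\mathbb{Q}Z\otimes\mathbb{Q}Z\to\mathbb{Q}Z$ be a commutative, associative, $\mathbb{Q}$-linear product. Let $\mathbb{Q}\langle Z\rangle$ be the $\mathbb{Q}$-vector space of noncommutative polynomials, with basis the words in $Z$. For $x\in\mathbb{Q}Z$ let $L_x$ be the linear map on $\mathbb{Q}\langle Z\rangle$ with $L_x(1)=0$ and $L_x(bw)=(x\lozenge b)w$ for every letter $b$ and word $w$, and let $\star$ be the bilinear product on $\mathbb{Q}\langle Z\rangle$ given recursively by $w\star 1=1\star w=w$ and $$au\star bv=a(u\star bv)+b(au\star v)-L_{a\lozenge b}(u\star v)$$ for letters $a,b$ and words $u,v,w$; it makes $\mathbb{Q}\langle Z\rangle$ a commutative associative algebra with unit the empty word. A word is Lyndon if it is nonempty and lexicographically strictly smaller than each of its nonempty proper right factors. Let every letter $z$ be given a positive integer length $\deg z$ in such a way that there are only finitely many letters of each length, and let the length of a word be the sum of the lengths of its letters. (If $Z$ is finite one may take $\deg z=1$ for all $z$, so that the length is the number of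 letters; for $Z=\{z_1,z_2,\ldots\}$ one may take $\deg z_i=i$.) Let $Z_n$ be the $\mathbb{Q}$-span of the words of length $n$ in $\mathbb{Q}\langle Z\rangle$. Then the Lyndon words are free commutative polynomial generators of $(\mathbb{Q}\langle Z\rangle,\star)$, that is, the homomorphism from the polynomial ring over $\mathbb{Q}$ in variables indexed by the Lyndon words to $(\mathbb{Q}\langle Z\rangle,\star)$ that sends each variable to its word is bijective. Every $Z_n$ is finite-dimensional, and if $Z(x)=\sum_{n\ge 0}(\dim Z_n)x^n$ is the Poincaré series and the rational numbers $c_n$ are defined by the identity of formal power series $$x\frac{d}{dx}\log Z(x)=\sum_{n\ge 1}c_nx^n,$$ then for every $n\ge 1$ the number $L_n$ of Lyndon generators of length $n$, i.e. of Lyndon words of length $n$, is finite and equals $$L_n=\frac1n\sum_{d\mid n}\mu\!\left(\frac nd\right)c_d,$$ where $\mu$ is the Möbius function. -/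

import Mathlib

noncomputable section

namespace GenQuasiShuffle

/-- A commutative, associative, `ℚ`-bilinear product `◊` on the vector space `ℚZ` with basis the
set of letters `Z`. -/
structure LetterProduct (Z : Type*) where
  /-- the bilinear product `◊` on `ℚZ` -/
  mul : (Z →₀ ℚ) →ₗ[ℚ] (Z →₀ ℚ) →ₗ[ℚ] (Z →₀ ℚ)
  mul_comm : ∀ x y, mul x y = mul y x
  mul_assoc : ∀ x y z, mul (mul x y) z = mul x (mul y z)

/-- The vector space `ℚ⟨Z⟩` of noncommutative polynomials: its basis is the set of words
(lists of letters), the empty word being `1`. -/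
abbrev NCPoly (Z : Type*) := List Z →₀ ℚ

variable {Z : Type*}

/-- Left multiplication (concatenation) by an element of `ℚZ`: `(x, w) ↦ x w`. -/
def prep : (Z →₀ ℚ) →ₗ[ℚ] NCPoly Z →ₗ[ℚ] NCPoly Z :=
  Finsupp.lift _ ℚ Z fun a => Finsupp.lmapDomain ℚ ℚ (List.cons a)

/-- The operator `L_x` on `ℚ⟨Z⟩`, linear in `x ∈ ℚZ`: `L_x (b w) = (x ◊ b) w` for a letter `b` and
a word `w`, and `L_x 1 = 0`. -/
def contract (D : LetterProduct Z) : (Z →₀ ℚ) →ₗ[ℚ] NCPoly Z →ₗ[ℚ] NCPoly Z :=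
  LinearMap.flip <| Finsupp.lift _ ℚ (List Z) fun w =>
    match w with
    | [] => 0
    | b :: v =>
      (LinearMap.flip prep (Finsupp.single v 1)).comp
        (LinearMap.flip D.mul (Finsupp.single b 1))

/-- The generalised quasi-shuffle product of two words:
`w ⋆ 1 = 1 ⋆ w = w`, `au ⋆ bv = a (u ⋆ bv) + b (au ⋆ v) - L_{a ◊ b} (u ⋆ v)`. -/
def starWord (D : LetterProduct Z) : List Z → List Z → NCPoly Z
  | [], v => Finsupp.single v 1
  | a :: u, [] => Finsupp.single (a :: u) 1
  | a :: u, b :: v =>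
    prep (Finsupp.single a 1) (starWord D u (b :: v))
      + prep (Finsupp.single b 1) (starWord D (a :: u) v)
      - contract D (D.mul (Finsupp.single a 1) (Finsupp.single b 1)) (starWord D u v)
  termination_by u v => u.length + v.length

/-- The bilinear extension of the generalised quasi-shuffle product to `ℚ⟨Z⟩`. -/
def star (D : LetterProduct Z) : NCPoly Z →ₗ[ℚ] NCPoly Z →ₗ[ℚ] NCPoly Z :=
  Finsupp.lift _ ℚ (List Z) fun u => Finsupp.lift _ ℚ (List Z) fun v => starWord D u v

/-! ### The product is commutative and associative -/

theorem prep_single (a : Z) (w : List Z) :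
    prep (Finsupp.single a 1) (Finsupp.single w 1) = Finsupp.single (a :: w) 1 := by
  simp [prep]

theorem contract_nil (D : LetterProduct Z) (x : Z →₀ ℚ) :
    contract D x (Finsupp.single [] 1) = 0 := by
  simp [contract]

theorem contract_prep (D : LetterProduct Z) (x y : Z →₀ ℚ) (p : NCPoly Z) :
    contract D x (prep y p) = prep (D.mul x y) p := by
  induction p using Finsupp.induction_linear with
  | zero => simp
  | add p q hp hq => simp [hp, hq]
  | single w r =>
    induction y using Finsupp.induction_linear with
    | zero => simp
    | add p q hp hq => simp only [map_add, LinearMap.add_apply, hp, hq]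
    | single b s =>
      have h1 : (Finsupp.single w r : NCPoly Z) = r • Finsupp.single w 1 := by simp
      have h2 : (Finsupp.single b s : Z →₀ ℚ) = s • Finsupp.single b 1 := by simp
      rw [h1, h2]
      simp only [map_smul, LinearMap.smul_apply, prep_single]
      congr 2
      simp [contract]

theorem contract_contract (D : LetterProduct Z) (x y : Z →₀ ℚ) (p : NCPoly Z) :
    contract D x (contract D y p) = contract D (D.mul x y) p := by
  induction p using Finsupp.induction_linear with
  | zero => simp
  | add p q hp hq => simp [hp, hq]
  | single w r =>
    have h1 : (Finsupp.single w r : NCPoly Z) = r • Finsupp.single w 1 := by simp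
    rw [h1]
    cases w with
    | nil => simp only [map_smul, contract_nil, smul_zero, map_zero]
    | cons b v =>
      rw [← prep_single]
      simp only [map_smul, contract_prep, D.mul_assoc]

theorem star_single (D : LetterProduct Z) (u v : List Z) :
    star D (Finsupp.single u 1) (Finsupp.single v 1) = starWord D u v := by
  simp [star]

theorem one_star (D : LetterProduct Z) (p : NCPoly Z) :
    star D (Finsupp.single [] 1) p = p := by
  induction p using Finsupp.induction_linear with
  | zero => simp
  | add p q hp hq => simp [hp, hq]
  | single w r =>
    have h1 : (Finsupp.single w r : NCPoly Z) = r • Finsupp.single w 1 := by simp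
    rw [h1, map_smul, star_single, starWord]

theorem starWord_comm (D : LetterProduct Z) (u v : List Z) :
    starWord D u v = starWord D v u := by
  induction hn : u.length + v.length using Nat.strong_induction_on generalizing u v with
  | _ n ih =>
    subst hn
    cases u with
    | nil => cases v <;> simp [starWord]
    | cons a u =>
      cases v with
      | nil => simp [starWord]
      | cons b v =>
        simp only [starWord]
        rw [ih _ (by simp) u (b :: v) rfl, ih _ (by simp) (a :: u) v rfl,
          ih _ (by simp; omega) u v rfl, D.mul_comm (Finsupp.single a 1)]
        abel

theorem star_comm (D : LetterProduct Z) (p q : NCPoly Z) : star D p q = star D q p := by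
  have h : star D = (star D).flip := by
    refine Finsupp.lhom_ext' fun u => LinearMap.ext_ring <| Finsupp.lhom_ext' fun v =>
      LinearMap.ext_ring ?_
    simp [star_single, starWord_comm D u v]
  exact congrArg (fun f => f p q) h

theorem star_one (D : LetterProduct Z) (p : NCPoly Z) :
    star D p (Finsupp.single [] 1) = p := by
  rw [star_comm, one_star]

theorem star_prep_prep (D : LetterProduct Z) (x y : Z →₀ ℚ) (p q : NCPoly Z) :
    star D (prep x p) (prep y q) =
      prep x (star D p (prep y q)) + prep y (star D (prep x p) q)
        - contract D (D.mul x y) (star D p q) := by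
  induction x using Finsupp.induction_linear with
  | zero => simp
  | add x x' h h' => simp only [map_add, LinearMap.add_apply, h, h']; abel
  | single a r =>
  induction y using Finsupp.induction_linear with
  | zero => simp
  | add x x' h h' => simp only [map_add, LinearMap.add_apply, h, h']; abel
  | single b s =>
  induction p using Finsupp.induction_linear with
  | zero => simp
  | add x x' h h' => simp only [map_add, LinearMap.add_apply, h, h']; abel
  | single u t =>
  induction q using Finsupp.induction_linear with
  | zero => simp
  | add x x' h h' => simp only [map_add, h, h']; abel
  | single v t' =>
    have h1 : (Finsupp.single a r : Z →₀ ℚ) = r • Finsupp.single a 1 := by simp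
    have h2 : (Finsupp.single b s : Z →₀ ℚ) = s • Finsupp.single b 1 := by simp
    have h3 : (Finsupp.single u t : NCPoly Z) = t • Finsupp.single u 1 := by simp
    have h4 : (Finsupp.single v t' : NCPoly Z) = t' • Finsupp.single v 1 := by simp
    rw [h1, h2, h3, h4]
    simp only [map_smul, LinearMap.smul_apply, prep_single, star_single]
    rw [starWord]
    module

theorem contract_star_prep (D : LetterProduct Z) (x y : Z →₀ ℚ) (p q : NCPoly Z) :
    star D (contract D x p) (prep y q) =
      contract D x (star D p (prep y q)) - prep (D.mul x y) (star D p q)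
        + prep y (star D (contract D x p) q) := by
  induction p using Finsupp.induction_linear with
  | zero => simp
  | add x x' h h' => simp only [map_add, LinearMap.add_apply, h, h']; abel
  | single u t =>
    have h3 : (Finsupp.single u t : NCPoly Z) = t • Finsupp.single u 1 := by simp
    rw [h3]
    simp only [map_smul, LinearMap.smul_apply]
    rw [← smul_sub, ← smul_add]
    congr 1
    cases u with
    | nil => simp only [contract_nil, one_star, contract_prep]; simp
    | cons e u =>
      rw [← prep_single]
      simp only [contract_prep, star_prep_prep, map_add, map_sub, contract_contract, D.mul_assoc]
      abel

theorem star_assoc_word (D : LetterProduct Z) (u v w : List Z) :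
    star D (star D (Finsupp.single u 1) (Finsupp.single v 1)) (Finsupp.single w 1) =
      star D (Finsupp.single u 1) (star D (Finsupp.single v 1) (Finsupp.single w 1)) := by
  induction hn : u.length + v.length + w.length using Nat.strong_induction_on
    generalizing u v w with
  | _ n ih =>
    subst hn
    rcases u with _ | ⟨a, u⟩
    · simp only [one_star]
    rcases v with _ | ⟨b, v⟩
    · simp only [one_star, star_one]
    rcases w with _ | ⟨c, w⟩
    · simp only [star_one]
    have e1 := ih _ (by simp) u (b :: v) (c :: w) rfl
    have e2 := ih _ (by simp) (a :: u) v (c :: w) rfl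
    have e3 := ih _ (by simp) (a :: u) (b :: v) w rfl
    have e4 := ih _ (by simp; omega) u (b :: v) w rfl
    have e5 := ih _ (by simp; omega) (a :: u) v w rfl
    have e6 := ih _ (by simp; omega) u v (c :: w) rfl
    have e7 := ih _ (by simp; omega) u v w rfl
    simp only [← prep_single] at e1 e2 e3 e4 e5 e6 e7 ⊢
    set A : Z →₀ ℚ := Finsupp.single a 1
    set B : Z →₀ ℚ := Finsupp.single b 1
    set C : Z →₀ ℚ := Finsupp.single c 1
    set U : NCPoly Z := Finsupp.single u 1
    set V : NCPoly Z := Finsupp.single v 1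
    set W : NCPoly Z := Finsupp.single w 1
    have left : star D (star D (prep A U) (prep B V)) (prep C W) =
        prep A (star D (star D U (prep B V)) (prep C W))
        + prep B (star D (star D (prep A U) V) (prep C W))
        + prep C (star D (star D (prep A U) (prep B V)) W)
        - contract D (D.mul A C) (star D (star D U (prep B V)) W)
        - contract D (D.mul B C) (star D (star D (prep A U) V) W)
        - contract D (D.mul A B) (star D (star D U V) (prep C W))
        + prep (D.mul (D.mul A B) C) (star D (star D U V) W) := by
      rw [star_prep_prep D A B]
      simp only [map_add, map_sub, LinearMap.add_apply, LinearMap.sub_apply]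
      rw [star_prep_prep D A C, star_prep_prep D B C, contract_star_prep]
      abel
    have right : star D (prep A U) (star D (prep B V) (prep C W)) =
        prep A (star D U (star D (prep B V) (prep C W)))
        + prep B (star D (prep A U) (star D V (prep C W)))
        + prep C (star D (prep A U) (star D (prep B V) W))
        - contract D (D.mul A C) (star D U (star D (prep B V) W))
        - contract D (D.mul B C) (star D (prep A U) (star D V W))
        - contract D (D.mul A B) (star D U (star D V (prep C W)))
        + prep (D.mul (D.mul A B) C) (star D U (star D V W)) := by
      rw [star_prep_prep D B C]
      simp only [map_add, map_sub]
      rw [star_prep_prep D A B, star_prep_prep D A C,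
        star_comm D (prep A U) (contract D (D.mul B C) (star D V W)), contract_star_prep,
        star_comm D (star D V W) (prep A U), star_comm D (star D V W) U,
        star_comm D (contract D (D.mul B C) (star D V W)) U, D.mul_comm (D.mul B C) A,
        ← D.mul_assoc A B C]
      abel
    rw [left, right, e1, e2, e3, e4, e5, e6, e7]

theorem star_assoc (D : LetterProduct Z) (p q r : NCPoly Z) :
    star D (star D p q) r = star D p (star D q r) := by
  induction p using Finsupp.induction_linear with
  | zero => simp only [map_zero, LinearMap.zero_apply]
  | add x x' h h' => simp only [map_add, LinearMap.add_apply, h, h']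
  | single u t =>
  induction q using Finsupp.induction_linear with
  | zero => simp only [map_zero, LinearMap.zero_apply]
  | add x x' h h' => simp only [map_add, LinearMap.add_apply, h, h']
  | single v t' =>
  induction r using Finsupp.induction_linear with
  | zero => simp only [map_zero]
  | add x x' h h' => rw [map_add, map_add, map_add, h, h']
  | single w t'' =>
    have h1 : (Finsupp.single u t : NCPoly Z) = t • Finsupp.single u 1 := by simp
    have h2 : (Finsupp.single v t' : NCPoly Z) = t' • Finsupp.single v 1 := by simp
    have h3 : (Finsupp.single w t'' : NCPoly Z) = t'' • Finsupp.single w 1 := by simp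
    rw [h1, h2, h3]
    simp only [map_smul, LinearMap.smul_apply, star_assoc_word]

/-! ### The algebra `(ℚ⟨Z⟩, ⋆)` -/

/-- The vector space `ℚ⟨Z⟩`, to be equipped with the product `⋆` determined by `◊`. -/
def StarAlg {Z : Type*} (_D : LetterProduct Z) : Type _ := NCPoly Z

instance (D : LetterProduct Z) : AddCommGroup (StarAlg D) :=
  inferInstanceAs (AddCommGroup (NCPoly Z))

instance (D : LetterProduct Z) : Module ℚ (StarAlg D) :=
  inferInstanceAs (Module ℚ (NCPoly Z))

/-- A word, as an element of `(ℚ⟨Z⟩, ⋆)`. -/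
def word (D : LetterProduct Z) (w : List Z) : StarAlg D :=
  (Finsupp.single w 1 : NCPoly Z)

/-- The commutative ring `(ℚ⟨Z⟩, ⋆)`; its unit is the empty word. -/
instance (D : LetterProduct Z) : CommRing (StarAlg D) :=
  { (inferInstance : AddCommGroup (StarAlg D)) with
    mul := fun p q => star D p q
    one := word D []
    left_distrib := fun p q r => map_add (star D p) q r
    right_distrib := fun p q r => LinearMap.map_add₂ (star D) p q r
    zero_mul := fun p => LinearMap.map_zero₂ (star D) p
    mul_zero := fun p => map_zero (star D p)
    mul_assoc := fun p q r => star_assoc D p q r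
    one_mul := fun p => one_star D p
    mul_one := fun p => star_one D p
    mul_comm := fun p q => star_comm D p q }

instance (D : LetterProduct Z) : Algebra ℚ (StarAlg D) :=
  Algebra.ofModule
    (fun r p q => LinearMap.map_smul₂ (star D) r p q)
    (fun r p q => map_smul (star D p) r q)

/-! ### Lyndon words, degrees, and the Poincaré series -/

/-- A Lyndon word: a nonempty word that is lexicographically strictly smaller than each of its
nonempty proper right factors. -/
def IsLyndon [LinearOrder Z] (w : List Z) : Prop :=
  w ≠ [] ∧ ∀ u v : List Z, u ≠ [] → v ≠ [] → w = u ++ v → w < v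

/-- The length of a word when the letter `z` is given length `deg z`: the sum of the lengths of its
letters. For `deg = 1` this is the number of letters. -/
def wordLength (deg : Z → ℕ) (w : List Z) : ℕ := (w.map deg).sum

/-- The subspace of `(ℚ⟨Z⟩, ⋆)` spanned by the words of length `n`. -/
def lengthPart (D : LetterProduct Z) (deg : Z → ℕ) (n : ℕ) : Submodule ℚ (StarAlg D) :=
  Submodule.span ℚ (word D '' {w | wordLength deg w = n})

/-- The Poincaré series `Z(x) = ∑ (dim Z_n) x^n`. -/
def poincareSeries (D : LetterProduct Z) (deg : Z → ℕ) : PowerSeries ℚ :=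
  PowerSeries.mk fun n => (Module.finrank ℚ (lengthPart D deg n) : ℚ)

/-- The coefficient `c_n` of `x^n` in `x (d/dx) log Z(x)`. -/
def logDerivCoeff (D : LetterProduct Z) (deg : Z → ℕ) (n : ℕ) : ℚ :=
  PowerSeries.coeff n
    (PowerSeries.X * PowerSeries.derivative ℚ (PowerSeries.logOf (poincareSeries D deg)))

/-- The set of Lyndon words of length `n`. -/
def lyndonWords [LinearOrder Z] (deg : Z → ℕ) (n : ℕ) : Set (List Z) :=
  {w | IsLyndon w ∧ wordLength deg w = n}

end GenQuasiShuffle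

end

noncomputable section

namespace GenQuasiShuffle

variable {Z : Type*}

/-! ### The lexicographic order and concatenation -/

section Lex

variable [LinearOrder Z]

/-! Freeness is a triangularity argument. In the recursion for `⋆` the contraction term loses two
letters, so in top letter count `⋆` is the ordinary shuffle product, with nonnegative coefficients,
whatever `◊` is (`starWord_apply_of_length_le`). The combinatorial core is `flatMap_snd_le`: if `l`
is Lyndon and every prefix of `v` precedes `l` in the order of infinite powers, then `l ++ v` is the
largest shuffle of `l` and `v`. Hence a product of Lyndon words `l₁ ≥ … ≥ lₖ` has leading word
`l₁…lₖ`, for the order by number of letters and then lexicographically (`hasLeadingWord_prod`). By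
the Chen–Fox–Lyndon factorization (`bijective_flatten_factors`) these leading words run through all
words exactly once, so monomials in the Lyndon words map to a basis.

The same factorization preserves length, so `dim Z_n` counts multisets of Lyndon words of total
length `n`. Counting the total length of these multisets in two ways (`mul_card_weight_eq`) gives `x
Z'(x) = C(x) Z(x)`, where `C` has coefficients `∑_{d ∣ n} d L_d`. Thus `c_n = ∑_{d ∣ n} d L_d`, and
Möbius inversion gives the formula. -/

theorem append_lt_append_left_iff {a b : List Z} (c : List Z) : c ++ a < c ++ b ↔ a < b := by
  induction c with
  | nil => rfl
  | cons x c ih =>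
    rw [List.cons_append, List.cons_append, List.cons_lt_cons_iff]
    simp [ih]

theorem append_le_append_left_iff {a b : List Z} (c : List Z) : c ++ a ≤ c ++ b ↔ a ≤ b := by
  rw [← not_lt, ← not_lt, append_lt_append_left_iff]

/-- Strict comparison of words neither of which is a prefix of the other persists under
extension. -/
theorem append_lt_append_of_not_prefix {a b : List Z} (h : a < b) (hp : ¬ a <+: b)
    (c d : List Z) : a ++ c < b ++ d := by
  induction a generalizing b with
  | nil => simp at hp
  | cons x a ih =>
    cases b with
    | nil => simp at h
    | cons y b =>
      rw [List.cons_append, List.cons_append, List.cons_lt_cons_iff]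
      rcases List.cons_lt_cons_iff.1 h with h' | ⟨rfl, h'⟩
      · exact Or.inl h'
      · exact Or.inr ⟨rfl, ih h' fun hp' => hp (by simpa using hp')⟩

theorem append_lt_append_of_length_eq {a b : List Z} (h : a < b) (hl : a.length = b.length)
    (c d : List Z) : a ++ c < b ++ d :=
  append_lt_append_of_not_prefix h (fun hp => h.ne (hp.eq_of_length hl)) c d

theorem append_le_append_of_length_eq {a b : List Z} (h : a ≤ b) (hl : a.length = b.length)
    (c : List Z) : a ++ c ≤ b ++ c := by
  rcases h.lt_or_eq with h | rfl
  · exact (append_lt_append_of_length_eq h hl c c).le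
  · rfl

theorem le_append_right (a b : List Z) : a ≤ a ++ b :=
  not_lt.1 (List.not_lt.2 List.le_append_left)

theorem take_le_take {a b : List Z} (h : a ≤ b) (hl : a.length = b.length) (n : ℕ) :
    a.take n ≤ b.take n := by
  by_contra! h'
  have := append_lt_append_of_length_eq h' (by simp [hl]) (b.drop n) (a.drop n)
  rw [List.take_append_drop, List.take_append_drop] at this
  exact this.not_ge h

/-! ### Comparison of infinite powers -/

/-- `u` precedes `v` when `uv ≤ vu`; for nonempty words this compares the infinite periodic words
`uuu…` and `vvv…`. -/
def PowLE (u v : List Z) : Prop := u ++ v ≤ v ++ u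

theorem PowLE.total (u v : List Z) : PowLE u v ∨ PowLE v u := le_total _ _

theorem PowLE.nil_left (u : List Z) : PowLE [] u := by simp [PowLE]

theorem PowLE.of_le {u v : List Z} (h : u ≤ v) (hl : u.length = v.length) : PowLE u v := by
  rcases h.lt_or_eq with h | rfl
  · exact (append_lt_append_of_length_eq h hl v u).le
  · exact le_refl (u ++ u)

/-- The exchange move: `cd` and `dc` have equal length, so their comparison survives any common
context. -/
theorem PowLE.swap {c d : List Z} (h : PowLE c d) (x y : List Z) :
    x ++ (c ++ (d ++ y)) ≤ x ++ (d ++ (c ++ y)) := by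
  rw [append_le_append_left_iff, ← List.append_assoc, ← List.append_assoc d]
  exact append_le_append_of_length_eq h (by simp [add_comm]) y

/-- Move `c` to the left past `b`, then past `a`: `abc ≤ acb ≤ cab`. -/
theorem PowLE.append_left {a b c : List Z} (ha : PowLE a c) (hb : PowLE b c) :
    PowLE (a ++ b) c := by
  have h1 := hb.swap a []
  have h2 := ha.swap [] b
  simp only [List.append_nil, List.nil_append] at h1 h2
  unfold PowLE
  simpa only [List.append_assoc] using h1.trans h2

theorem PowLE.append_right {a b c : List Z} (ha : PowLE c a) (hb : PowLE c b) :
    PowLE c (a ++ b) := by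
  have h1 := ha.swap [] b
  have h2 := hb.swap a []
  simp only [List.append_nil, List.nil_append] at h1 h2
  unfold PowLE
  simpa only [List.append_assoc] using h1.trans h2

theorem not_powLE_append_left {a b c : List Z} (ha : ¬ PowLE a c) (hb : ¬ PowLE b c) :
    ¬ PowLE (a ++ b) c := by
  unfold PowLE at *
  rw [not_le] at *
  have h1 := append_lt_append_of_length_eq ha (by simp [add_comm]) b b
  have h2 := (append_lt_append_left_iff a).2 hb
  simp only [List.append_assoc] at h1 h2 ⊢
  exact h1.trans h2

theorem not_powLE_append_right {a b c : List Z} (ha : ¬ PowLE c a) (hb : ¬ PowLE c b) :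
    ¬ PowLE c (a ++ b) := by
  unfold PowLE at *
  rw [not_le] at *
  have h1 := append_lt_append_of_length_eq ha (by simp [add_comm]) b b
  have h2 := (append_lt_append_left_iff a).2 hb
  simp only [List.append_assoc] at h1 h2 ⊢
  exact h2.trans h1

/-- The `n`-th power of a word. -/
def wpow (u : List Z) (n : ℕ) : List Z := (List.replicate n u).flatten

omit [LinearOrder Z] in
theorem wpow_succ (u : List Z) (n : ℕ) : wpow u (n + 1) = u ++ wpow u n := by
  simp [wpow, List.replicate_succ]

omit [LinearOrder Z] in
theorem length_wpow (u : List Z) (n : ℕ) : (wpow u n).length = n * u.length := by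
  simp [wpow]

theorem PowLE.wpow_left {u v : List Z} (h : PowLE u v) (n : ℕ) : PowLE (wpow u n) v := by
  induction n with
  | zero => exact PowLE.nil_left v
  | succ n ih => rw [wpow_succ]; exact h.append_left ih

theorem PowLE.wpow_right {u v : List Z} (h : PowLE u v) (n : ℕ) : PowLE u (wpow v n) := by
  induction n with
  | zero => simp [PowLE, wpow]
  | succ n ih => rw [wpow_succ]; exact h.append_right ih

theorem not_powLE_wpow_left {u v : List Z} (h : ¬ PowLE u v) {n : ℕ} (hn : 0 < n) :
    ¬ PowLE (wpow u n) v := by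
  obtain ⟨n, rfl⟩ := Nat.exists_eq_succ_of_ne_zero hn.ne'
  induction n with
  | zero => simpa [wpow] using h
  | succ n ih => rw [Nat.succ_eq_add_one, wpow_succ]; exact not_powLE_append_left h (ih (by simp))

theorem not_powLE_wpow_right {u v : List Z} (h : ¬ PowLE u v) {n : ℕ} (hn : 0 < n) :
    ¬ PowLE u (wpow v n) := by
  obtain ⟨n, rfl⟩ := Nat.exists_eq_succ_of_ne_zero hn.ne'
  induction n with
  | zero => simpa [wpow] using h
  | succ n ih => rw [Nat.succ_eq_add_one, wpow_succ]; exact not_powLE_append_right h (ih (by simp))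

/-- Taking powers preserves both `PowLE` and its negation, and on words of equal length `PowLE` is
the lexicographic order. This reduces transitivity of `PowLE` to that of `≤`. -/
theorem powLE_iff_wpow_le {u v : List Z} {m n : ℕ} (hm : 0 < m) (hn : 0 < n)
    (h : m * u.length = n * v.length) : PowLE u v ↔ wpow u m ≤ wpow v n := by
  have hl : (wpow u m).length = (wpow v n).length := by rw [length_wpow, length_wpow, h]
  refine ⟨fun h => ?_, fun h => ?_⟩
  · by_contra! h'
    exact (append_lt_append_of_length_eq h' hl.symm _ _).not_ge ((h.wpow_left m).wpow_right n)
  · by_contra h'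
    exact not_powLE_wpow_right (not_powLE_wpow_left h' hm) hn (PowLE.of_le h hl)

/-- The middle word must be nonempty, since `[]` is related to every word in both directions. -/
theorem PowLE.trans {u v w : List Z} (hv : v ≠ []) (h1 : PowLE u v) (h2 : PowLE v w) :
    PowLE u w := by
  rcases eq_or_ne u [] with rfl | hu
  · exact PowLE.nil_left w
  rcases eq_or_ne w [] with rfl | hw
  · simp [PowLE]
  have hu := List.length_pos_iff.2 hu
  have hv := List.length_pos_iff.2 hv
  have hw := List.length_pos_iff.2 hw
  -- The exponents bring powers of all three words to the common length `|u||v||w|`.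
  rw [powLE_iff_wpow_le (m := v.length * w.length) (n := u.length * v.length) (by positivity)
    (by positivity) (by ring)]
  rw [powLE_iff_wpow_le (m := v.length * w.length) (n := u.length * w.length) (by positivity)
    (by positivity) (by ring)] at h1
  rw [powLE_iff_wpow_le (m := u.length * w.length) (n := u.length * v.length) (by positivity)
    (by positivity) (by ring)] at h2
  exact h1.trans h2

/-! ### Lyndon words -/

theorem IsLyndon.powLE {p s : List Z} (h : IsLyndon (p ++ s)) : PowLE p s := by
  rcases eq_or_ne p [] with rfl | hp
  · exact PowLE.nil_left s
  rcases eq_or_ne s [] with rfl | hs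
  · simp [PowLE]
  exact ((h.2 p s hp hs rfl).trans_le (le_append_right s p)).le

/-- If `m` is not a prefix of `l`, a letter decides the comparison. If `l = mz`, Lyndonness gives
`mz ≤ zm`, and prepending `m` yields `ml ≤ lm`. -/
theorem IsLyndon.powLE_of_le {l m : List Z} (hl : IsLyndon l) (h : m ≤ l) : PowLE m l := by
  by_cases hp : m <+: l
  · obtain ⟨z, rfl⟩ := hp
    have := (append_le_append_left_iff m).2 hl.powLE
    unfold PowLE
    simpa using this
  · rcases h.lt_or_eq with h | rfl
    · exact (append_lt_append_of_not_prefix h hp _ _).le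
    · exact absurd (List.prefix_refl _) hp

theorem IsLyndon.powLE_of_prefix {m r : List Z} (hm : IsLyndon m) (h : r <+: m) : PowLE r m :=
  hm.powLE_of_le (by obtain ⟨z, rfl⟩ := h; exact le_append_right r z)

/-- Every prefix of `v` precedes `l` in the order of infinite powers. -/
def PrefixPowLE (v l : List Z) : Prop := ∀ q, q <+: v → PowLE q l

theorem PrefixPowLE.of_le {v w l : List Z} (h : PrefixPowLE w l) (hvw : v ≤ w)
    (hl : v.length = w.length) : PrefixPowLE v l := by
  intro q hq
  rcases eq_or_ne q [] with rfl | hq0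
  · exact PowLE.nil_left l
  rw [List.prefix_iff_eq_take.1 hq] at hq0 ⊢
  have hlen : (v.take q.length).length = (w.take q.length).length := by simp [hl]
  refine PowLE.trans ?_ (PowLE.of_le (take_le_take hvw hl _) hlen) (h _ (List.take_prefix _ _))
  intro h0
  rw [h0] at hlen
  exact hq0 (List.length_eq_zero_iff.1 hlen)

/-- A prefix of the concatenation consists of whole factors followed by a prefix of one factor `m`.
Each factor precedes `l`, and so does a prefix of `m`, by transitivity through `m`. -/
theorem prefixPowLE_flatten {l : List Z} (hl : IsLyndon l) {L : List (List Z)}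
    (hL : ∀ m ∈ L, IsLyndon m ∧ m ≤ l) : PrefixPowLE L.flatten l := by
  induction L with
  | nil => intro q hq; simp at hq; subst hq; exact PowLE.nil_left l
  | cons m L ih =>
    intro q hq
    obtain ⟨hm, hml⟩ := hL m (by simp)
    rw [List.flatten_cons] at hq
    rcases List.prefix_or_prefix_of_prefix hq (List.prefix_append m _) with hq' | ⟨r, rfl⟩
    · replace hq := hq'
      exact (hm.powLE_of_prefix hq).trans hm.1 (hl.powLE_of_le hml)
    · exact (hl.powLE_of_le hml).append_left
        (ih (fun m hm => hL m (by simp [hm])) r ((List.prefix_append_right_inj m).1 hq))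

/-! ### The largest shuffle -/

/-- The concatenation of the blocks carrying the tag `t`. -/
def tagged (t : Bool) (B : List (Bool × List Z)) : List Z :=
  (B.filter fun b => b.1 == t).flatMap Prod.snd

omit [LinearOrder Z] in
theorem tagged_cons_self (t : Bool) (p : List Z) (B : List (Bool × List Z)) :
    tagged t ((t, p) :: B) = p ++ tagged t B := by
  simp [tagged]

omit [LinearOrder Z] in
theorem tagged_cons_ne {s t : Bool} (h : s ≠ t) (p : List Z) (B : List (Bool × List Z)) :
    tagged t ((s, p) :: B) = tagged t B := by
  simp [tagged, h]

theorem not_powLE_tagged {t : Bool} {p : List Z} {B : List (Bool × List Z)}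
    (h : ∀ b ∈ B, ¬ PowLE p b.2) (h0 : tagged t B ≠ []) : ¬ PowLE p (tagged t B) := by
  induction B with
  | nil => simp [tagged] at h0
  | cons b B ih =>
    obtain ⟨s, q⟩ := b
    by_cases hs : s = t
    · subst hs
      rw [tagged_cons_self] at h0 ⊢
      by_cases hB : tagged s B = []
      · rw [hB, List.append_nil]
        exact h (s, q) (by simp)
      · exact not_powLE_append_right (h (s, q) (by simp))
          (ih (fun b hb => h b (List.mem_cons_of_mem _ hb)) hB)
    · rw [tagged_cons_ne hs] at h0 ⊢
      exact ih (fun b hb => h b (by simp [hb])) h0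

/-- Induction on the number of blocks. Adjacent blocks of equal tag merge. Adjacent blocks `c`, `d`
with `PowLE c d` can be exchanged without decreasing the word, after which one of them merges with a
neighbour. When neither move applies, the blocks strictly decrease for `PowLE`, and the hypotheses
on `l` and `v` then force the word to be `l ++ v`. -/
theorem flatMap_snd_le {l v : List Z} (hl : IsLyndon l) (hv : PrefixPowLE v l)
    (B : List (Bool × List Z)) (hB : ∀ b ∈ B, b.2 ≠ []) (hBl : tagged true B = l)
    (hBv : tagged false B = v) : B.flatMap Prod.snd ≤ l ++ v := by
  induction hn : B.length using Nat.strong_induction_on generalizing B with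
  | _ n ih =>
  subst hn
  by_cases hmerge : ∃ X Y s p q, B = X ++ (s, p) :: (s, q) :: Y
  · obtain ⟨X, Y, s, p, q, rfl⟩ := hmerge
    have key := ih _ (by simp) (X ++ (s, p ++ q) :: Y) ?_ ?_ ?_ rfl
    · simpa using key
    · intro b hb
      simp only [List.mem_append, List.mem_cons] at hb
      rcases hb with hb | rfl | hb
      · exact hB b (by simp [hb])
      · exact fun h => hB (s, p) (by simp) (List.append_eq_nil_iff.1 h).1
      · exact hB b (by simp [hb])
    · rw [← hBl]
      cases s <;> simp [tagged]
    · rw [← hBv]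
      cases s <;> simp [tagged]
  -- From here on the tags alternate.
  have hne : ∀ X Y s t p q, B = X ++ (s, p) :: (t, q) :: Y → s = !t := by
    intro X Y s t p q h
    have : s ≠ t := by
      rintro rfl
      exact hmerge ⟨X, Y, s, p, q, h⟩
    revert this
    cases s <;> cases t <;> simp
  by_cases hswap : ∃ X Y c d, B = X ++ c :: d :: Y ∧ PowLE c.2 d.2
  · obtain ⟨X, Y, ⟨s, c⟩, ⟨t, d⟩, rfl, hcd⟩ := hswap
    obtain rfl := hne X Y s t c d rfl
    -- With only two blocks the word is `lv` or `vl`, and the claim is immediate. Otherwise the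
    -- exchange puts `c` next to the block after the pair, or `d` next to the block before it, and
    -- these have equal tags.
    rcases List.eq_nil_or_concat X with rfl | ⟨X, ⟨r, e⟩, rfl⟩
    · rcases Y with _ | ⟨⟨r, f⟩, Y⟩
      · rw [← hBl, ← hBv]
        cases t
        · simp [tagged]
        · simpa [tagged, PowLE] using hcd
      · obtain rfl : t = !r := hne [(!t, c)] Y t r d f rfl
        have key := ih _ (by simp) ((!r, d) :: (r, c ++ f) :: Y) ?_ ?_ ?_ rfl
        · refine le_trans ?_ key
          simpa using hcd.swap [] (f ++ Y.flatMap Prod.snd)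
        · intro b hb
          simp only [List.mem_cons] at hb
          rcases hb with rfl | rfl | hb
          · exact hB _ (by simp)
          · exact fun h => hB (r, f) (by simp) (List.append_eq_nil_iff.1 h).2
          · exact hB b (by simp [hb])
        · rw [← hBl]
          cases r <;> simp [tagged]
        · rw [← hBv]
          cases r <;> simp [tagged]
    · obtain rfl : r = t := by
        have := hne X ((t, d) :: Y) r (!t) e c (by simp)
        simpa using this
      have key := ih _ (by simp) (X ++ (r, e ++ d) :: (!r, c) :: Y) ?_ ?_ ?_ rfl
      · refine le_trans ?_ key
        simpa using hcd.swap (X.flatMap Prod.snd ++ e) (Y.flatMap Prod.snd)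
      · intro b hb
        simp only [List.mem_append, List.mem_cons] at hb
        rcases hb with hb | rfl | rfl | hb
        · exact hB b (by simp [hb])
        · exact fun h => hB (r, d) (by simp) (List.append_eq_nil_iff.1 h).2
        · exact hB _ (by simp)
        · exact hB b (by simp [hb])
      · rw [← hBl]
        cases r <;> simp [tagged]
      · rw [← hBv]
        cases r <;> simp [tagged]
  -- Nonemptiness is built into `R` because transitivity of `PowLE` needs a nonempty middle word.
  let R : Bool × List Z → Bool × List Z → Prop := fun c d => c.2 ≠ [] ∧ ¬ PowLE c.2 d.2
  have : IsTrans _ R := ⟨fun a b c hab hbc => ⟨hab.1, fun h =>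
    hbc.2 (((PowLE.total a.2 b.2).resolve_left hab.2).trans hab.1 h)⟩⟩
  have hpw : B.Pairwise R := by
    rw [← List.isChain_iff_pairwise, List.isChain_iff_forall_rel_of_append_cons_cons]
    intro a b X Y h
    exact ⟨hB a (by simp [h]), fun h' => hswap ⟨X, Y, a, b, h, h'⟩⟩
  rcases B with _ | ⟨⟨s, p⟩, B⟩
  · exact absurd hBl.symm hl.1
  rw [List.pairwise_cons] at hpw
  have hp : p ≠ [] := hB (s, p) (by simp)
  -- If the first block `p` comes from `v`, it is a prefix of `v`, so it precedes `l`; yet it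
  -- strictly exceeds every block of `l`, hence `l` itself. If it comes from `l = ps` with `s`
  -- nonempty, Lyndonness gives `PowLE p s`, although `p` strictly exceeds every block of `s`. So `p
  -- = l`, and only `v` follows.
  cases s
  · rw [tagged_cons_ne (by simp)] at hBl
    refine absurd (hv p ?_) (hBl ▸ not_powLE_tagged (fun b hb => (hpw.1 b hb).2) (hBl ▸ hl.1))
    rw [← hBv, tagged_cons_self]
    exact List.prefix_append _ _
  · rw [tagged_cons_self] at hBl
    by_cases h0 : tagged true B = []
    · have hBf : ∀ b ∈ B, b.1 = false := by
        intro b hb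
        by_contra hbt
        simp only [tagged, List.flatMap_eq_nil_iff, List.mem_filter] at h0
        exact hB b (List.mem_cons_of_mem _ hb) (h0 b ⟨hb, by simpa using hbt⟩)
      have hBe : tagged false B = B.flatMap Prod.snd := by
        rw [tagged, List.filter_eq_self.2 fun b hb => by simp [hBf b hb]]
      rw [tagged_cons_ne (by simp), hBe] at hBv
      rw [← hBl, ← hBv, h0]
      simp
    · exact absurd (hBl ▸ hl).powLE (not_powLE_tagged (fun b hb => (hpw.1 b hb).2) h0)

end Lex

/-! ### Factorization into Lyndon words -/

section Factorization

variable [LinearOrder Z]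

theorem isLyndon_singleton (a : Z) : IsLyndon [a] := by
  refine ⟨by simp, fun u v hu hv h => ?_⟩
  have := congrArg List.length h
  have h1 := List.length_pos_iff.2 hu
  have h2 := List.length_pos_iff.2 hv
  simp at this
  omega

/-- First `lm < m`. A right factor inside `m` is at least `m`. One of the form `rm`, with `r` a
proper right factor of `l`, exceeds `lm` because `l < r` and `l` is too long to be a prefix of `r`.
-/
theorem IsLyndon.append {l m : List Z} (hl : IsLyndon l) (hm : IsLyndon m) (h : l < m) :
    IsLyndon (l ++ m) := by
  have hlm : l ++ m < m := by
    by_cases hp : l <+: m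
    · obtain ⟨m', rfl⟩ := hp
      rw [append_lt_append_left_iff]
      exact hm.2 l m' hl.1 (by rintro rfl; simp at h) rfl
    · simpa using append_lt_append_of_not_prefix h hp m []
  refine ⟨by simp [hl.1], fun u v hu hv huv => ?_⟩
  rcases List.append_eq_append_iff.1 huv with ⟨s, rfl, hs⟩ | ⟨r, hr, rfl⟩
  · rcases eq_or_ne s [] with rfl | hs0
    · simpa [hs] using hlm
    · exact hlm.trans (hm.2 s v hs0 hv hs)
  · rcases eq_or_ne r [] with rfl | hr0
    · simpa using hlm
    · refine append_lt_append_of_not_prefix (hl.2 u r hu hr0 hr) (fun hp => ?_) m m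
      have h1 := hp.length_le
      have h2 := List.length_pos_iff.2 hu
      rw [hr, List.length_append] at h1
      omega

/-- A nonincreasing sequence of Lyndon words. -/
def IsLyndonSeq (L : List (List Z)) : Prop := (∀ l ∈ L, IsLyndon l) ∧ L.Pairwise (· ≥ ·)

theorem IsLyndonSeq.tail {l : List Z} {L : List (List Z)} (h : IsLyndonSeq (l :: L)) :
    IsLyndonSeq L :=
  ⟨fun m hm => h.1 m (by simp [hm]), h.2.of_cons⟩

theorem IsLyndonSeq.le_head {l : List Z} {L : List (List Z)} (h : IsLyndonSeq (l :: L)) :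
    ∀ m ∈ L, m ≤ l :=
  (List.pairwise_cons.1 h.2).1

/-- Two adjacent factors `l < m` merge into the Lyndon word `lm`. Each merge lowers the number of
factors, and when none is possible the sequence is nonincreasing. -/
theorem exists_lyndonSeq_of_forall (L : List (List Z)) (hL : ∀ l ∈ L, IsLyndon l) :
    ∃ M, IsLyndonSeq M ∧ M.flatten = L.flatten := by
  induction hn : L.length using Nat.strong_induction_on generalizing L with
  | _ n ih =>
  subst hn
  by_cases h : ∃ X Y l m, L = X ++ l :: m :: Y ∧ l < m
  · obtain ⟨X, Y, l, m, rfl, hlm⟩ := h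
    obtain ⟨M, hM, hMe⟩ := ih _ (by simp) (X ++ (l ++ m) :: Y) (fun x hx => by
      simp only [List.mem_append, List.mem_cons] at hx
      rcases hx with hx | rfl | hx
      · exact hL x (by simp [hx])
      · exact (hL l (by simp)).append (hL m (by simp)) hlm
      · exact hL x (by simp [hx])) rfl
    exact ⟨M, hM, by simpa using hMe⟩
  · refine ⟨L, ⟨hL, ?_⟩, rfl⟩
    rw [← List.isChain_iff_pairwise, List.isChain_iff_forall_rel_of_append_cons_cons]
    intro a b X Y hX
    exact not_lt.1 fun hab => h ⟨X, Y, a, b, hX, hab⟩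

theorem exists_lyndonSeq (w : List Z) : ∃ L, IsLyndonSeq L ∧ L.flatten = w := by
  obtain ⟨M, hM, h⟩ := exists_lyndonSeq_of_forall (w.map fun a => [a]) (by
    simp only [List.mem_map]
    rintro _ ⟨a, -, rfl⟩
    exact isLyndon_singleton a)
  refine ⟨M, hM, h.trans ?_⟩
  clear h
  induction w <;> simp_all

omit [LinearOrder Z] in
theorem exists_suffix_prefix_of_prefix_flatten {L : List (List Z)} {t : List Z} (ht : t ≠ [])
    (h : t <+: L.flatten) : ∃ s r, t = s ++ r ∧ r ≠ [] ∧ ∃ m ∈ L, r <+: m := by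
  induction L generalizing t with
  | nil => simp at h; exact absurd h ht
  | cons m L ih =>
    rw [List.flatten_cons] at h
    rcases List.prefix_or_prefix_of_prefix h (List.prefix_append m _) with h' | ⟨t', rfl⟩
    · exact ⟨[], t, rfl, ht, m, by simp, h'⟩
    · rcases eq_or_ne t' [] with rfl | ht'
      · exact ⟨[], m, by simp, by simpa using ht, m, by simp, List.prefix_refl m⟩
      · obtain ⟨s, r, rfl, hr, m', hm', hrm⟩ := ih ht' ((List.prefix_append_right_inj m).1 h)
        exact ⟨m ++ s, r, by simp, hr, m', by simp [hm'], hrm⟩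

/-- If `l` were longer than `m`, it would end in a nonempty prefix `r` of a later factor `m'`,
giving `l < r ≤ m' ≤ m ≤ l`. Applied in both directions, this shows that two factorizations of a
word have the same head. -/
theorem IsLyndonSeq.length_le_head {l m : List Z} {M : List (List Z)} (hl : IsLyndon l)
    (hM : IsLyndonSeq (m :: M)) (h : l <+: (m :: M).flatten) : l.length ≤ m.length := by
  by_contra! hlt
  rw [List.flatten_cons] at h
  rcases List.prefix_or_prefix_of_prefix h (List.prefix_append m _) with h' | ⟨t, rfl⟩
  · exact absurd h'.length_le (by omega)
  · obtain ⟨s, r, rfl, hr, m', hm', y, rfl⟩ := exists_suffix_prefix_of_prefix_flatten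
      (by rintro rfl; simp at hlt) ((List.prefix_append_right_inj m).1 h)
    have h1 := hl.2 (m ++ s) r (by simp [(hM.1 m (by simp)).1]) hr (by simp)
    have h2 := (le_append_right r y).trans (hM.le_head _ hm')
    exact ((h1.trans_le h2).trans_le (le_append_right m (s ++ r))).false

theorem IsLyndonSeq.eq_of_flatten_eq {L M : List (List Z)} (hL : IsLyndonSeq L)
    (hM : IsLyndonSeq M) (h : L.flatten = M.flatten) : L = M := by
  induction L generalizing M with
  | nil =>
    rcases M with _ | ⟨m, M⟩
    · rfl
    · exact absurd (List.append_eq_nil_iff.1 h.symm).1 (hM.1 m (by simp)).1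
  | cons l L ih =>
    rcases M with _ | ⟨m, M⟩
    · exact absurd (List.append_eq_nil_iff.1 h).1 (hL.1 l (by simp)).1
    · have h1 := hM.length_le_head (hL.1 l (by simp)) (h ▸ List.prefix_append l _)
      have h2 := hL.length_le_head (hM.1 m (by simp)) (h ▸ List.prefix_append m _)
      obtain ⟨rfl, h'⟩ := List.append_inj h (le_antisymm h1 h2)
      rw [ih hL.tail hM.tail h']

end Factorization

/-! ### The leading part of the product of two words -/

open Classical in
theorem prep_single_apply_cons (a : Z) (p : NCPoly Z) (c : Z) (y : List Z) :
    prep (Finsupp.single a 1) p (c :: y) = if c = a then p y else 0 := by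
  simp only [prep, Finsupp.lift_apply, zero_smul, Finsupp.sum_single_index, one_smul,
    Finsupp.lmapDomain_apply]
  split_ifs with h
  · subst h
    exact Finsupp.mapDomain_apply List.cons_injective p y
  · exact Finsupp.mapDomain_of_notMem_range p _ (by simpa using fun x => by tauto)

/-- The polynomials in words with at most `n` letters. -/
def lettersLE (Z : Type*) (n : ℕ) : Submodule ℚ (NCPoly Z) :=
  Finsupp.supported ℚ ℚ {w | w.length ≤ n}

theorem lettersLE_mono {m n : ℕ} (h : m ≤ n) : lettersLE Z m ≤ lettersLE Z n :=
  Finsupp.supported_mono fun _ hw => le_trans hw h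

theorem single_mem_lettersLE {w : List Z} {n : ℕ} (h : w.length ≤ n) (r : ℚ) :
    (Finsupp.single w r : NCPoly Z) ∈ lettersLE Z n :=
  Finsupp.single_mem_supported ℚ r h

theorem apply_eq_zero_of_mem_lettersLE {p : NCPoly Z} {n : ℕ} (h : p ∈ lettersLE Z n)
    {w : List Z} (hw : n < w.length) : p w = 0 :=
  (Finsupp.mem_supported' ℚ p).1 h w (by simpa using hw)

theorem map_mem_of_forall_word {n : ℕ} (f : NCPoly Z →ₗ[ℚ] NCPoly Z)
    {S : Submodule ℚ (NCPoly Z)}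
    (h : ∀ w : List Z, w.length ≤ n → f (Finsupp.single w 1) ∈ S) {p : NCPoly Z}
    (hp : p ∈ lettersLE Z n) : f p ∈ S := by
  rw [lettersLE, Finsupp.supported_eq_span_single] at hp
  refine (Submodule.span_le.2 ?_ : _ ≤ S.comap f) hp
  rintro _ ⟨w, hw, rfl⟩
  exact h w hw

theorem prep_mem_lettersLE (x : Z →₀ ℚ) {p : NCPoly Z} {n : ℕ} (hp : p ∈ lettersLE Z n) :
    prep x p ∈ lettersLE Z (n + 1) := by
  refine map_mem_of_forall_word (prep x) (fun w hw => ?_) hp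
  induction x using Finsupp.induction_linear with
  | zero => simp
  | add x y hx hy => rw [map_add]; exact add_mem hx hy
  | single a r =>
    rw [← mul_one r, ← smul_eq_mul, ← Finsupp.smul_single, map_smul, LinearMap.smul_apply,
      prep_single]
    exact Submodule.smul_mem _ _ (single_mem_lettersLE (by simpa using hw) 1)

theorem contract_mem_lettersLE (D : LetterProduct Z) (x : Z →₀ ℚ) {p : NCPoly Z} {n : ℕ}
    (hp : p ∈ lettersLE Z n) : contract D x p ∈ lettersLE Z n := by
  refine map_mem_of_forall_word (contract D x) (fun w hw => ?_) hp
  rcases w with _ | ⟨b, v⟩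
  · rw [contract_nil]; exact zero_mem _
  · rw [← prep_single, contract_prep]
    exact lettersLE_mono hw (prep_mem_lettersLE _ (single_mem_lettersLE le_rfl 1))

theorem starWord_mem_lettersLE (D : LetterProduct Z) (u v : List Z) :
    starWord D u v ∈ lettersLE Z (u.length + v.length) := by
  induction hn : u.length + v.length using Nat.strong_induction_on generalizing u v with
  | _ n ih =>
    subst hn
    rcases u with _ | ⟨a, u⟩
    · rw [starWord]; exact single_mem_lettersLE (by simp) 1
    rcases v with _ | ⟨b, v⟩
    · rw [starWord]; exact single_mem_lettersLE (by simp) 1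
    rw [starWord]
    refine sub_mem (add_mem ?_ ?_) ?_
    · exact lettersLE_mono (by simp)
        (prep_mem_lettersLE _ (ih _ (by simp) u (b :: v) rfl))
    · exact lettersLE_mono (by simp)
        (prep_mem_lettersLE _ (ih _ (by simp) (a :: u) v rfl))
    · exact lettersLE_mono (by simp; omega)
        (contract_mem_lettersLE D _ (ih _ (by simp; omega) u v rfl))

/-- `x` is a shuffle of `u` and `v`: it is cut into nonempty blocks, which carry the letters of `u`
and of `v`. -/
def IsShuffle (u v x : List Z) : Prop :=
  ∃ B : List (Bool × List Z), (∀ b ∈ B, b.2 ≠ []) ∧ tagged true B = u ∧ tagged false B = v ∧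
    B.flatMap Prod.snd = x

theorem IsShuffle.nil_left (v : List Z) : IsShuffle [] v v := by
  rcases eq_or_ne v [] with rfl | hv
  · exact ⟨[], by simp, by simp [tagged], by simp [tagged], by simp⟩
  · exact ⟨[(false, v)], by simpa, by simp [tagged], by simp [tagged], by simp⟩

theorem IsShuffle.nil_right (u : List Z) : IsShuffle u [] u := by
  rcases eq_or_ne u [] with rfl | hu
  · exact ⟨[], by simp, by simp [tagged], by simp [tagged], by simp⟩
  · exact ⟨[(true, u)], by simpa, by simp [tagged], by simp [tagged], by simp⟩

theorem IsShuffle.cons_left {u v x : List Z} (h : IsShuffle u v x) (a : Z) :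
    IsShuffle (a :: u) v (a :: x) := by
  obtain ⟨B, h0, h1, h2, h3⟩ := h
  exact ⟨(true, [a]) :: B, by simpa using h0, by simp [tagged_cons_self, h1],
    by simp [tagged_cons_ne, h2], by simp [h3]⟩

theorem IsShuffle.cons_right {u v x : List Z} (h : IsShuffle u v x) (a : Z) :
    IsShuffle u (a :: v) (a :: x) := by
  obtain ⟨B, h0, h1, h2, h3⟩ := h
  exact ⟨(false, [a]) :: B, by simpa using h0, by simp [tagged_cons_ne, h1],
    by simp [tagged_cons_self, h2], by simp [h3]⟩

theorem IsShuffle.perm {u v x : List Z} (h : IsShuffle u v x) : x.Perm (u ++ v) := by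
  obtain ⟨B, -, rfl, rfl, rfl⟩ := h
  induction B with
  | nil => simp [tagged]
  | cons b B ih =>
    obtain ⟨t, p⟩ := b
    cases t
    · rw [tagged_cons_self, tagged_cons_ne (by simp), List.flatMap_cons]
      exact (ih.append_left p).trans
        (by simpa using List.perm_append_comm_assoc p (tagged true B) (tagged false B))
    · rw [tagged_cons_self, tagged_cons_ne (by simp), List.flatMap_cons, List.append_assoc]
      exact ih.append_left p

/-- The contraction term has too few letters to contribute at `x`, so only the two shuffle terms of
the recursion remain. Nonnegativity excludes cancellation between them. -/
theorem starWord_apply_of_length_le (D : LetterProduct Z) (u v x : List Z)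
    (hx : u.length + v.length ≤ x.length) :
    0 ≤ starWord D u v x ∧ (starWord D u v x ≠ 0 → IsShuffle u v x) := by
  classical
  induction hn : u.length + v.length using Nat.strong_induction_on generalizing u v x with
  | _ n ih =>
    subst hn
    rcases u with _ | ⟨a, u⟩
    · rw [starWord, Finsupp.single_apply]
      split_ifs with h
      · exact ⟨zero_le_one, fun _ => h ▸ IsShuffle.nil_left _⟩
      · simp
    rcases v with _ | ⟨b, v⟩
    · rw [starWord, Finsupp.single_apply]
      split_ifs with h
      · exact ⟨zero_le_one, fun _ => h ▸ IsShuffle.nil_right _⟩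
      · simp
    rcases x with _ | ⟨c, x⟩
    · simp at hx
    simp only [List.length_cons] at hx
    obtain ⟨h1, h1'⟩ := ih _ (by simp) u (b :: v) x (by simp; omega) rfl
    obtain ⟨h2, h2'⟩ := ih _ (by simp) (a :: u) v x (by simp; omega) rfl
    have h3 := apply_eq_zero_of_mem_lettersLE
      (contract_mem_lettersLE D (D.mul (Finsupp.single a 1) (Finsupp.single b 1))
        (starWord_mem_lettersLE D u v)) (w := c :: x) (by simp; omega)
    rw [starWord, Finsupp.sub_apply, Finsupp.add_apply, h3, prep_single_apply_cons,
      prep_single_apply_cons, sub_zero]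
    refine ⟨add_nonneg (by split_ifs <;> simp [h1]) (by split_ifs <;> simp [h2]), fun h => ?_⟩
    by_cases hA : c = a ∧ starWord D u (b :: v) x ≠ 0
    · rw [hA.1]
      exact (h1' hA.2).cons_left a
    by_cases hB : c = b ∧ starWord D (a :: u) v x ≠ 0
    · rw [hB.1]
      exact (h2' hB.2).cons_right b
    · refine absurd ?_ h
      rw [ite_eq_right_iff.2 (by tauto), ite_eq_right_iff.2 (by tauto), add_zero]

theorem starWord_apply_append_pos (D : LetterProduct Z) (u v : List Z) :
    0 < starWord D u v (u ++ v) := by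
  classical
  induction u with
  | nil => simp [starWord]
  | cons a u ih =>
    rcases v with _ | ⟨b, v⟩
    · simp [starWord]
    have h2 := (starWord_apply_of_length_le D (a :: u) v (u ++ b :: v) (by simp; omega)).1
    have h3 := apply_eq_zero_of_mem_lettersLE
      (contract_mem_lettersLE D (D.mul (Finsupp.single a 1) (Finsupp.single b 1))
        (starWord_mem_lettersLE D u v)) (w := a :: u ++ b :: v) (by simp)
    rw [starWord, Finsupp.sub_apply, Finsupp.add_apply, h3, List.cons_append,
      prep_single_apply_cons, prep_single_apply_cons, sub_zero, if_pos rfl]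
    refine add_pos_of_pos_of_nonneg ih ?_
    split_ifs <;> simp [h2]

/-! ### Triangularity of the products of Lyndon words -/

/-- The underlying noncommutative polynomial of an element of `(ℚ⟨Z⟩, ⋆)`. -/
def toNC (D : LetterProduct Z) : StarAlg D ≃ₗ[ℚ] NCPoly Z := LinearEquiv.refl ℚ (NCPoly Z)

theorem toNC_word (D : LetterProduct Z) (w : List Z) : toNC D (word D w) = Finsupp.single w 1 := rfl

theorem toNC_one (D : LetterProduct Z) : toNC D 1 = Finsupp.single [] 1 := rfl

theorem toNC_mul (D : LetterProduct Z) (p q : StarAlg D) :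
    toNC D (p * q) = star D (toNC D p) (toNC D q) := rfl

section Triangular

variable [LinearOrder Z]

/-- The words below `w`: those with fewer letters, and the lexicographically smaller rearrangements
of `w`. -/
def below (w : List Z) : Set (List Z) := {x | x.length < w.length ∨ (x.Perm w ∧ x < w)}

/-- `p` is a nonzero multiple of `w`, up to words below `w`. -/
def HasLeadingWord (p : NCPoly Z) (w : List Z) : Prop :=
  ∃ c : ℚ, c ≠ 0 ∧ p - Finsupp.single w c ∈ Finsupp.supported ℚ ℚ (below w)

/-- The lower terms of `p` must stay lower after multiplication by `l`. For a smaller rearrangement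
`x` of `w` the prefix condition passes from `w` to `x`, so a full-length shuffle `y` of `l` and `x`
satisfies `y ≤ lx < lw`. -/
theorem starWord_mem_below (D : LetterProduct Z) {l w x : List Z} (hl : IsLyndon l)
    (hw : PrefixPowLE w l) (hx : x ∈ below w) :
    starWord D l x ∈ Finsupp.supported ℚ ℚ (below (l ++ w)) := by
  rw [Finsupp.mem_supported']
  intro y hy
  by_contra h0
  rcases lt_or_ge y.length (l ++ w).length with hlt | hge
  · exact hy (Or.inl hlt)
  rw [List.length_append] at hge
  rcases hx with hx | ⟨hperm, hx⟩
  · exact h0 (apply_eq_zero_of_mem_lettersLE (starWord_mem_lettersLE D l x) (by omega))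
  · have hlen := hperm.length_eq
    have hsh := (starWord_apply_of_length_le D l x y (by omega)).2 h0
    obtain ⟨B, hB, hB1, hB2, rfl⟩ := id hsh
    have hle := flatMap_snd_le hl (hw.of_le hx.le hlen) B hB hB1 hB2
    exact hy (Or.inr ⟨hsh.perm.trans (hperm.append_left l),
      hle.trans_lt ((append_lt_append_left_iff l).2 hx)⟩)

theorem hasLeadingWord_starWord (D : LetterProduct Z) {l w : List Z} (hl : IsLyndon l)
    (hw : PrefixPowLE w l) : HasLeadingWord (starWord D l w) (l ++ w) := by
  refine ⟨starWord D l w (l ++ w), (starWord_apply_append_pos D l w).ne', ?_⟩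
  rw [Finsupp.mem_supported']
  intro y hy
  rw [Finsupp.sub_apply]
  rcases eq_or_ne y (l ++ w) with rfl | hne
  · simp
  rw [Finsupp.single_eq_of_ne hne, sub_zero]
  by_contra h0
  rcases lt_or_ge y.length (l ++ w).length with hlt | hge
  · exact hy (Or.inl hlt)
  rw [List.length_append] at hge
  have hsh := (starWord_apply_of_length_le D l w y hge).2 h0
  obtain ⟨B, hB, hB1, hB2, rfl⟩ := id hsh
  exact hy (Or.inr ⟨hsh.perm, (flatMap_snd_le hl hw B hB hB1 hB2).lt_of_ne hne⟩)

theorem HasLeadingWord.star (D : LetterProduct Z) {l w : List Z} {p : NCPoly Z}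
    (hl : IsLyndon l) (hw : PrefixPowLE w l) (hp : HasLeadingWord p w) :
    HasLeadingWord (star D (Finsupp.single l 1) p) (l ++ w) := by
  obtain ⟨c, hc, hpc⟩ := hp
  obtain ⟨d, hd, hdw⟩ := hasLeadingWord_starWord D hl hw
  refine ⟨c * d, mul_ne_zero hc hd, ?_⟩
  have h1 : GenQuasiShuffle.star D (Finsupp.single l 1) (p - Finsupp.single w c) ∈
      Finsupp.supported ℚ ℚ (below (l ++ w)) := by
    rw [Finsupp.supported_eq_span_single] at hpc
    refine (Submodule.span_le.2 ?_ : _ ≤ (Finsupp.supported ℚ ℚ (below (l ++ w))).comap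
      (GenQuasiShuffle.star D (Finsupp.single l 1))) hpc
    rintro _ ⟨x, hx, rfl⟩
    simpa only [SetLike.mem_coe, Submodule.mem_comap, star_single] using
      starWord_mem_below D hl hw hx
  have h2 : (Finsupp.single w c : NCPoly Z) = c • Finsupp.single w 1 := by simp
  have h3 : (Finsupp.single (l ++ w) (c * d) : NCPoly Z) = c • Finsupp.single (l ++ w) d := by simp
  rw [h2, map_sub, map_smul, star_single] at h1
  rw [h3]
  -- The remainder splits as `l ⋆ (p - c w) + c (l ⋆ w - d lw)`.
  convert add_mem h1 (Submodule.smul_mem _ c hdw) using 1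
  module

theorem hasLeadingWord_prod (D : LetterProduct Z) {L : List (List Z)} (hL : IsLyndonSeq L) :
    HasLeadingWord (toNC D (L.map (word D)).prod) L.flatten := by
  induction L with
  | nil => exact ⟨1, one_ne_zero, by simp [toNC_one]⟩
  | cons l L ih =>
    have hl := hL.1 l (by simp)
    rw [List.map_cons, List.prod_cons, toNC_mul, toNC_word]
    exact (ih hL.tail).star D hl
      (prefixPowLE_flatten hl fun m hm => ⟨hL.1 m (by simp [hm]), hL.le_head m hm⟩)

/-! ### Monomials in the Lyndon words -/

variable (Z) in
/-- The type of Lyndon words. -/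
abbrev Lyndon := {w : List Z // IsLyndon w}

/-- The factors of a monomial in the Lyndon words, in nonincreasing order. -/
def factors (m : Lyndon Z →₀ ℕ) : List (List Z) :=
  ((Finsupp.toMultiset m).map Subtype.val).sort (· ≥ ·)

theorem coe_factors (m : Lyndon Z →₀ ℕ) :
    (factors m : Multiset (List Z)) = (Finsupp.toMultiset m).map Subtype.val :=
  Multiset.sort_eq _ _

theorem isLyndonSeq_factors (m : Lyndon Z →₀ ℕ) : IsLyndonSeq (factors m) := by
  refine ⟨fun l hl => ?_, Multiset.pairwise_sort _ _⟩
  rw [← Multiset.mem_coe, coe_factors, Multiset.mem_map] at hl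
  obtain ⟨x, -, rfl⟩ := hl
  exact x.2

/-- The Chen–Fox–Lyndon theorem: injectivity is uniqueness of the nonincreasing factorization,
surjectivity its existence. -/
theorem bijective_flatten_factors :
    Function.Bijective fun m : Lyndon Z →₀ ℕ => (factors m).flatten := by
  constructor
  · intro m m' h
    have h1 := congrArg (fun L : List (List Z) => (L : Multiset (List Z)))
      ((isLyndonSeq_factors m).eq_of_flatten_eq (isLyndonSeq_factors m') h)
    simp only [coe_factors] at h1
    exact Multiset.toFinsupp.symm.injective (Multiset.map_injective Subtype.val_injective h1)
  · intro w
    obtain ⟨L, hL, rfl⟩ := exists_lyndonSeq w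
    refine ⟨Multiset.toFinsupp (L.pmap Subtype.mk hL.1 : List (Lyndon Z)), ?_⟩
    refine congrArg List.flatten (List.Perm.eq_of_pairwise' (isLyndonSeq_factors _).2 hL.2 ?_)
    rw [← Multiset.coe_eq_coe, coe_factors, Multiset.toFinsupp_toMultiset, Multiset.map_coe,
      List.map_pmap]
    simp

/-- Words correspond to monomials in the Lyndon words. -/
def factorEquiv : (Lyndon Z →₀ ℕ) ≃ List Z := Equiv.ofBijective _ bijective_flatten_factors

/-- The algebra map from the polynomial ring in the Lyndon words. -/
abbrev lyndonEval (D : LetterProduct Z) : MvPolynomial (Lyndon Z) ℚ →ₐ[ℚ] StarAlg D :=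
  MvPolynomial.aeval fun w : Lyndon Z => word D w.1

theorem lyndonEval_monomial (D : LetterProduct Z) (m : Lyndon Z →₀ ℕ) :
    lyndonEval D (MvPolynomial.monomial m 1) = ((factors m).map (word D)).prod := by
  rw [← Multiset.prod_coe, ← Multiset.map_coe, coe_factors, MvPolynomial.aeval_monomial, map_one,
    one_mul, Multiset.map_map]
  induction m using Finsupp.induction_linear with
  | zero => simp
  | add m m' h h' =>
    rw [Finsupp.prod_add_index' (by simp) (by simp [pow_add]), h, h', map_add, Multiset.map_add,
      Multiset.prod_add]
  | single w k => simp [Finsupp.toMultiset_single, Multiset.map_nsmul, Multiset.prod_nsmul]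

theorem hasLeadingWord_lyndonEval (D : LetterProduct Z) (m : Lyndon Z →₀ ℕ) :
    HasLeadingWord (toNC D (lyndonEval D (MvPolynomial.monomial m 1))) (factorEquiv m) := by
  rw [lyndonEval_monomial]
  exact hasLeadingWord_prod D (isLyndonSeq_factors m)

/-- The words below `w` precede it in the order by number of letters, then lexicographically. -/
theorem toLex_lt_of_mem_below {x w : List Z} (h : x ∈ below w) :
    toLex (x.length, x) < toLex (w.length, w) := by
  rw [Prod.Lex.toLex_lt_toLex]
  exact h.imp id fun h => ⟨h.1.length_eq, h.2⟩

/-! ### Bijectivity of the evaluation map -/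

/-- Among the monomials of a nonzero polynomial take the one with the largest leading word. Distinct
monomials have distinct leading words, so nothing cancels that coefficient. -/
theorem lyndonEval_injective (D : LetterProduct Z) : Function.Injective (lyndonEval D) := by
  rw [injective_iff_map_eq_zero]
  intro p hp
  by_contra hp0
  obtain ⟨m₀, hm₀, hmax⟩ := Finset.exists_max_image p.support
    (fun m => toLex ((factorEquiv m).length, factorEquiv m))
    (MvPolynomial.support_nonempty.2 hp0)
  have hsum : toNC D (lyndonEval D p) = ∑ m ∈ p.support, p.coeff m •
      toNC D (lyndonEval D (MvPolynomial.monomial m 1)) := by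
    conv_lhs => rw [p.as_sum, map_sum, map_sum]
    refine Finset.sum_congr rfl fun m _ => ?_
    rw [← map_smul, ← map_smul, MvPolynomial.smul_monomial, smul_eq_mul, mul_one]
  have hzero : ∀ m ∈ p.support, m ≠ m₀ →
      toNC D (lyndonEval D (MvPolynomial.monomial m 1)) (factorEquiv m₀) = 0 := by
    intro m hm hne
    obtain ⟨c, -, hc⟩ := hasLeadingWord_lyndonEval D m
    have := (Finsupp.mem_supported' ℚ _).1 hc (factorEquiv m₀)
      fun h => (toLex_lt_of_mem_below h).not_ge (hmax m hm)
    rwa [Finsupp.sub_apply, Finsupp.single_eq_of_ne (by simpa using hne.symm), sub_zero] at this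
  obtain ⟨c, hc0, hc⟩ := hasLeadingWord_lyndonEval D m₀
  have hc' := (Finsupp.mem_supported' ℚ _).1 hc (factorEquiv m₀)
    fun h => (toLex_lt_of_mem_below h).false
  rw [Finsupp.sub_apply, Finsupp.single_eq_same, sub_eq_zero] at hc'
  have h0 := DFunLike.congr_fun (hsum.symm.trans (by rw [hp, map_zero])) (factorEquiv m₀)
  rw [Finsupp.finsetSum_apply, Finset.sum_eq_single_of_mem m₀ hm₀ fun m hm hne => by
    rw [Finsupp.smul_apply, hzero m hm hne, smul_zero], Finsupp.smul_apply, hc'] at h0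
  exact mul_ne_zero (MvPolynomial.mem_support_iff.1 hm₀) hc0 h0

/-- The lexicographic order need not be well-founded, but a word has only finitely many
rearrangements. So induct on the number of letters and take the least counterexample among the
rearrangements. -/
theorem below_induction {P : List Z → Prop} (h : ∀ w, (∀ x ∈ below w, P x) → P w) (w : List Z) :
    P w := by
  induction hn : w.length using Nat.strong_induction_on generalizing w with
  | _ n ih =>
    subst hn
    by_contra hw
    have hfin : {x : List Z | x.Perm w ∧ ¬ P x}.Finite :=
      (List.finite_toSet w.permutations).subset fun x hx => List.mem_permutations.2 hx.1
    obtain ⟨x, ⟨hxw, hx⟩, hmin⟩ := Set.exists_min_image _ id hfin ⟨w, List.Perm.refl w, hw⟩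
    refine hx (h x fun y hy => ?_)
    rcases hy with hy | ⟨hyx, hy⟩
    · exact ih _ (hxw.length_eq ▸ hy) y rfl
    · by_contra hPy
      exact (hmin y ⟨hyx.trans hxw, hPy⟩).not_gt hy

theorem word_mem_range_lyndonEval (D : LetterProduct Z) (w : List Z) :
    word D w ∈ LinearMap.range (lyndonEval D).toLinearMap := by
  induction w using below_induction with
  | h w ih =>
    obtain ⟨m, rfl⟩ := factorEquiv.surjective w
    obtain ⟨c, hc0, hc⟩ := hasLeadingWord_lyndonEval D m
    rw [Finsupp.supported_eq_span_single] at hc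
    have h1 := (Submodule.span_le.2 ?_ : _ ≤
      (LinearMap.range (lyndonEval D).toLinearMap).comap (toNC D).symm.toLinearMap) hc
    swap
    · rintro _ ⟨x, hx, rfl⟩
      exact ih x hx
    have h2 : lyndonEval D (MvPolynomial.monomial m 1) - c • word D (factorEquiv m) ∈
        LinearMap.range (lyndonEval D).toLinearMap := by
      convert Submodule.mem_comap.1 h1 using 1
      apply (toNC D).injective
      rw [map_sub, map_smul, toNC_word, Finsupp.smul_single, smul_eq_mul, mul_one]
      exact ((toNC D).apply_symm_apply _).symm
    have h3 := (Submodule.sub_mem_iff_right _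
      (LinearMap.mem_range_self (lyndonEval D).toLinearMap _)).1 h2
    exact (Submodule.smul_mem_iff _ hc0).1 h3

omit [LinearOrder Z] in
theorem span_range_word (D : LetterProduct Z) : Submodule.span ℚ (Set.range (word D)) = ⊤ :=
  (Finsupp.basisSingleOne (R := ℚ) (ι := List Z)).span_eq.symm ▸ by
    congr 1

theorem lyndonEval_bijective (D : LetterProduct Z) : Function.Bijective (lyndonEval D) := by
  refine ⟨lyndonEval_injective D, ?_⟩
  have h : LinearMap.range (lyndonEval D).toLinearMap = ⊤ := by
    rw [eq_top_iff, ← span_range_word, Submodule.span_le]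
    rintro _ ⟨w, rfl⟩
    exact word_mem_range_lyndonEval D w
  exact LinearMap.range_eq_top.1 h

end Triangular

/-! ### Counting weighted multisets -/

/-- Removing `j` copies of `w` is a bijection onto the multisets of weight `n - j * ℓ w`. -/
theorem card_filter_le_apply {σ : Type*} {ℓ : σ → ℕ} {A : ℕ → Finset (σ →₀ ℕ)}
    (hA : ∀ n m, m ∈ A n ↔ Finsupp.weight ℓ m = n) (n j : ℕ) (w : σ) :
    ((A n).filter fun m => j ≤ m w).card = if j * ℓ w ≤ n then (A (n - j * ℓ w)).card else 0 := by
  classical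
  have hadd : ∀ m : σ →₀ ℕ, Finsupp.weight ℓ (m + Finsupp.single w j) =
      Finsupp.weight ℓ m + j * ℓ w := fun m => by
    rw [map_add, Finsupp.weight_single, smul_eq_mul]
  have hsub : ∀ m : σ →₀ ℕ, j ≤ m w → m - Finsupp.single w j + Finsupp.single w j = m :=
    fun m hm => tsub_add_cancel_of_le (Finsupp.single_le_iff.2 hm)
  split_ifs with h
  · refine Finset.card_nbij' (· - Finsupp.single w j) (· + Finsupp.single w j) ?_ ?_ ?_ ?_
    · intro m hm
      simp only [Finset.coe_filter, Set.mem_ofPred_eq, hA] at hm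
      have := hadd (m - Finsupp.single w j)
      rw [hsub m hm.2, hm.1] at this
      simp only [Finset.mem_coe, hA]
      omega
    · intro m hm
      simp only [Finset.mem_coe, hA] at hm
      simp only [Finset.coe_filter, Set.mem_ofPred_eq, hA, hadd, hm, Finsupp.add_apply,
        Finsupp.single_eq_same]
      omega
    · intro m hm
      simp only [Finset.coe_filter, Set.mem_ofPred_eq] at hm
      exact hsub m hm.2
    · intro m _
      exact add_tsub_cancel_right m _
  · rw [Finset.card_eq_zero, Finset.filter_eq_empty_iff]
    intro m hm hj
    have := hadd (m - Finsupp.single w j)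
    rw [hsub m hj, (hA n m).1 hm] at this
    omega

theorem sum_Icc_multiples (n d : ℕ) (hd : 0 < d) (g : ℕ → ℕ) :
    ∑ j ∈ Finset.Icc 1 n, (if j * d ≤ n then g (j * d) else 0) =
      ∑ k ∈ Finset.Icc 1 n, if d ∣ k then g k else 0 := by
  rw [← Finset.sum_filter, ← Finset.sum_filter]
  refine Finset.sum_nbij' (· * d) (· / d) ?_ ?_ ?_ ?_ fun _ _ => rfl
  · intro j hj
    simp only [Finset.mem_filter, Finset.mem_Icc] at hj ⊢
    exact ⟨⟨Nat.mul_pos hj.1.1 hd, hj.2⟩, dvd_mul_left d j⟩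
  · intro k hk
    simp only [Finset.mem_filter, Finset.mem_Icc] at hk ⊢
    rw [Nat.div_mul_cancel hk.2]
    exact ⟨⟨Nat.div_pos (Nat.le_of_dvd hk.1.1 hk.2) hd, (Nat.div_le_self k d).trans hk.1.2⟩,
      hk.1.2⟩
  · intro j _
    exact Nat.mul_div_cancel j hd
  · intro k hk
    exact Nat.div_mul_cancel (Finset.mem_filter.1 hk).2

/-- The number `A n` of multisets of weight `n` on a set with `S d` elements of weight `d`. -/
theorem mul_card_weight_eq {σ : Type*} {ℓ : σ → ℕ} (hℓ : ∀ w, 0 < ℓ w)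
    {A : ℕ → Finset (σ →₀ ℕ)} (hA : ∀ n m, m ∈ A n ↔ Finsupp.weight ℓ m = n)
    {S : ℕ → Finset σ} (hS : ∀ d w, w ∈ S d ↔ ℓ w = d) (n : ℕ) :
    n * (A n).card =
      ∑ k ∈ Finset.Icc 1 n, (∑ d ∈ k.divisors, d * (S d).card) * (A (n - k)).card := by
  classical
  have hdisj : (Finset.Icc 1 n : Set ℕ).PairwiseDisjoint S := by
    intro d _ e _ hde
    refine Finset.disjoint_left.2 fun w hd he => hde ?_
    rw [← (hS d w).1 hd, (hS e w).1 he]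
  have hweight : ∀ m ∈ A n, n = ∑ d ∈ Finset.Icc 1 n, ∑ w ∈ S d, m w * ℓ w := by
    intro m hm
    rw [← Finset.sum_biUnion hdisj]
    conv_lhs => rw [← (hA n m).1 hm, Finsupp.weight_apply]
    refine Finsupp.sum_of_support_subset _ (fun w hw => ?_) _ (by simp)
    rw [Finset.mem_biUnion]
    refine ⟨ℓ w, Finset.mem_Icc.2 ⟨hℓ w, ?_⟩, (hS _ w).2 rfl⟩
    rw [← (hA n m).1 hm]
    exact Finsupp.le_weight_of_ne_zero' ℓ (Finsupp.mem_support_iff.1 hw)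
  -- The multiplicity `m w` is the number of `j ≥ 1` with `j ≤ m w`; exchange the two sums.
  have hmult : ∀ w, ∑ m ∈ A n, m w =
      ∑ j ∈ Finset.Icc 1 n, if j * ℓ w ≤ n then (A (n - j * ℓ w)).card else 0 := by
    intro w
    simp_rw [← card_filter_le_apply hA n, Finset.card_filter]
    rw [Finset.sum_comm]
    refine Finset.sum_congr rfl fun m hm => ?_
    have hle : m w ≤ n := (hA n m).1 hm ▸ Finsupp.le_weight ℓ (hℓ w).ne' m
    rw [← Finset.card_filter]
    have : (Finset.Icc 1 n).filter (fun j => j ≤ m w) = Finset.Icc 1 (m w) := by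
      ext j
      simp only [Finset.mem_filter, Finset.mem_Icc]
      omega
    rw [this, Nat.card_Icc, Nat.add_sub_cancel]
  -- Each multiset contributes its weight `n`. Redistribute the total over the elements `w`, then
  -- collect by the weight `k = j * d` of the `j` copies.
  calc n * (A n).card = ∑ m ∈ A n, n := by rw [Finset.sum_const, smul_eq_mul, mul_comm]
    _ = ∑ m ∈ A n, ∑ d ∈ Finset.Icc 1 n, ∑ w ∈ S d, m w * ℓ w := Finset.sum_congr rfl hweight
    _ = ∑ d ∈ Finset.Icc 1 n, ∑ w ∈ S d, (∑ m ∈ A n, m w) * ℓ w := by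
      rw [Finset.sum_comm]
      refine Finset.sum_congr rfl fun d _ => ?_
      rw [Finset.sum_comm]
      simp_rw [Finset.sum_mul]
    _ = ∑ d ∈ Finset.Icc 1 n, ∑ k ∈ Finset.Icc 1 n,
          if d ∣ k then d * (S d).card * (A (n - k)).card else 0 := by
      refine Finset.sum_congr rfl fun d hd => ?_
      have h1 : ∀ w ∈ S d, (∑ m ∈ A n, m w) * ℓ w =
          (∑ k ∈ Finset.Icc 1 n, if d ∣ k then (A (n - k)).card else 0) * d := by
        intro w hw
        rw [hmult, (hS d w).1 hw,
          sum_Icc_multiples n d (Finset.mem_Icc.1 hd).1 fun k => (A (n - k)).card]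
      rw [Finset.sum_congr rfl h1, Finset.sum_const, smul_eq_mul, Finset.sum_mul, Finset.mul_sum]
      refine Finset.sum_congr rfl fun k _ => ?_
      split_ifs <;> ring
    _ = _ := by
      rw [Finset.sum_comm]
      refine Finset.sum_congr rfl fun k hk => ?_
      rw [Finset.mem_Icc] at hk
      rw [← Finset.sum_filter, Finset.sum_mul]
      refine Finset.sum_congr ?_ fun _ _ => rfl
      ext d
      simp only [Finset.mem_filter, Finset.mem_Icc, Nat.mem_divisors]
      constructor
      · rintro ⟨-, h⟩
        exact ⟨h, by omega⟩
      · rintro ⟨h, -⟩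
        exact ⟨⟨Nat.pos_of_dvd_of_pos h hk.1, (Nat.le_of_dvd hk.1 h).trans hk.2⟩, h⟩

/-! ### The logarithmic derivative of a power series -/

open PowerSeries in
-- Substitute `F - 1` into `log'(1 + X) · (1 + X) = 1` and apply the chain rule.
theorem derivative_logOf_mul {F : PowerSeries ℚ} (hF : constantCoeff F = 1) :
    d⁄dX ℚ (logOf F) * F = d⁄dX ℚ F := by
  have hsub : HasSubst (F - 1) := HasSubst.of_constantCoeff_zero' (by simp [hF])
  have hgeom : d⁄dX ℚ (log ℚ) * (1 + X) = 1 := by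
    rw [deriv_log]
    ext n
    rw [mul_add, mul_one, map_add]
    rcases n with _ | n
    · simp
    · simp [coeff_succ_mul_X, coeff_one, pow_succ]
  have h := congrArg (substAlgHom (R := ℚ) hsub) hgeom
  rw [map_mul, map_add, map_one, coe_substAlgHom, subst_X hsub, add_sub_cancel] at h
  rw [logOf_eq, derivative_subst hsub, mul_right_comm, h, one_mul, map_sub]
  simp

/-! ### Words of given length -/

section Counting

theorem wordLength_nil (deg : Z → ℕ) : wordLength deg [] = 0 := rfl

theorem wordLength_cons (deg : Z → ℕ) (a : Z) (w : List Z) :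
    wordLength deg (a :: w) = deg a + wordLength deg w := by
  simp [wordLength]

theorem wordLength_flatten (deg : Z → ℕ) (L : List (List Z)) :
    wordLength deg L.flatten = (L.map (wordLength deg)).sum := by
  induction L with
  | nil => rfl
  | cons l L ih =>
    rw [List.map_cons, List.sum_cons, ← ih]
    simp [wordLength]

/-- A nonempty word of length `n` has a first letter among the finitely many of length at most `n`.
Since that letter has positive length, the remaining word is shorter. -/
theorem finite_wordLength_eq {deg : Z → ℕ} (hdeg : ∀ z, 0 < deg z)
    (hfin : ∀ n, {z | deg z = n}.Finite) (n : ℕ) : {w | wordLength deg w = n}.Finite := by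
  induction n using Nat.strong_induction_on with
  | _ n ih =>
    have hletters : {z | deg z ≤ n}.Finite :=
      ((Set.finite_Iic n).biUnion fun k _ => hfin k).subset fun z hz => by simpa using hz
    have hwords : (⋃ k ∈ Set.Iio n, {w | wordLength deg w = k}).Finite :=
      (Set.finite_Iio n).biUnion ih
    refine ((Set.finite_singleton []).union (hletters.image2 List.cons hwords)).subset ?_
    rintro (_ | ⟨a, w⟩) hw
    · simp
    · rw [Set.mem_ofPred_eq, wordLength_cons] at hw
      have := hdeg a
      refine Or.inr ⟨a, ?_, w, ?_, rfl⟩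
      · rw [Set.mem_ofPred_eq]; omega
      · simp only [Set.mem_Iio, Set.mem_iUnion, Set.mem_ofPred_eq, exists_prop, exists_eq_right']
        omega

theorem linearIndependent_word (D : LetterProduct Z) : LinearIndependent ℚ (word D) :=
  (Finsupp.basisSingleOne (R := ℚ) (ι := List Z)).linearIndependent

theorem finrank_lengthPart (D : LetterProduct Z) {deg : Z → ℕ} (hdeg : ∀ z, 0 < deg z)
    (hfin : ∀ n, {z | deg z = n}.Finite) (n : ℕ) :
    Module.finrank ℚ (lengthPart D deg n) = (finite_wordLength_eq hdeg hfin n).toFinset.card := by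
  classical
  have h := finrank_span_finset_eq_card (R := ℚ)
    (s := (finite_wordLength_eq hdeg hfin n).toFinset.image (word D))
    (by
      rw [Finset.coe_image]
      exact (linearIndependent_word D).linearIndepOn_id.mono (Set.image_subset_range _ _))
  rw [Finset.card_image_of_injective _ (linearIndependent_word D).injective, Finset.coe_image,
    Set.Finite.coe_toFinset] at h
  exact h

variable [LinearOrder Z]

theorem wordLength_factorEquiv (deg : Z → ℕ) (m : Lyndon Z →₀ ℕ) :
    wordLength deg (factorEquiv m) =
      Finsupp.weight (fun w : Lyndon Z => wordLength deg w.1) m := by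
  have h : wordLength deg (factorEquiv m) =
      (((Finsupp.toMultiset m).map Subtype.val).map (wordLength deg)).sum := by
    rw [← coe_factors, Multiset.map_coe, Multiset.sum_coe, ← wordLength_flatten]
    rfl
  rw [h, Multiset.map_map]
  clear h
  induction m using Finsupp.induction_linear with
  | zero => simp
  | add m m' h h' => rw [map_add, map_add, Multiset.map_add, Multiset.sum_add, h, h']
  | single w k =>
    simp [Finsupp.toMultiset_single, Multiset.map_nsmul, Multiset.sum_nsmul, Finsupp.weight_single]

theorem IsLyndon.wordLength_pos {deg : Z → ℕ} (hdeg : ∀ z, 0 < deg z) {w : List Z}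
    (hw : IsLyndon w) : 0 < wordLength deg w := by
  rcases w with _ | ⟨a, w⟩
  · exact absurd rfl hw.1
  · rw [wordLength_cons]
    exact Nat.add_pos_left (hdeg a) _

theorem finite_lyndonWords {deg : Z → ℕ} (hdeg : ∀ z, 0 < deg z)
    (hfin : ∀ n, {z | deg z = n}.Finite) (n : ℕ) : (lyndonWords deg n).Finite :=
  (finite_wordLength_eq hdeg hfin n).subset fun _ hw => hw.2

/-! ### The recursion for the dimensions and Möbius inversion -/

theorem mul_finrank_lengthPart (D : LetterProduct Z) {deg : Z → ℕ} (hdeg : ∀ z, 0 < deg z)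
    (hfin : ∀ n, {z | deg z = n}.Finite) (n : ℕ) :
    n * Module.finrank ℚ (lengthPart D deg n) =
      ∑ k ∈ Finset.Icc 1 n, (∑ d ∈ k.divisors, d * (lyndonWords (Z := Z) deg d).ncard) *
        Module.finrank ℚ (lengthPart D deg (n - k)) := by
  let A : ℕ → Finset (Lyndon Z →₀ ℕ) := fun n =>
    (finite_wordLength_eq hdeg hfin n).toFinset.map factorEquiv.symm.toEmbedding
  let S : ℕ → Finset (Lyndon Z) := fun n =>
    ((finite_wordLength_eq hdeg hfin n).preimage Subtype.val_injective.injOn).toFinset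
  have hS : ∀ n, (S n).card = (lyndonWords (Z := Z) deg n).ncard := by
    intro n
    rw [← Set.ncard_coe_finset, ← Set.ncard_image_of_injective _ Subtype.val_injective]
    congr 1
    ext w
    simp [S, lyndonWords, and_comm]
  have key := mul_card_weight_eq (ℓ := fun w : Lyndon Z => wordLength deg w.1)
    (fun w => w.2.wordLength_pos hdeg) (A := A) (S := S)
    (fun n m => by
      rw [← wordLength_factorEquiv]
      simp [A, Finset.mem_map_equiv])
    (fun d w => by simp [S]) n
  simpa only [A, Finset.card_map, hS, ← finrank_lengthPart D hdeg hfin] using key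

omit [LinearOrder Z] in
theorem finrank_lengthPart_zero (D : LetterProduct Z) {deg : Z → ℕ} (hdeg : ∀ z, 0 < deg z)
    (hfin : ∀ n, {z | deg z = n}.Finite) : Module.finrank ℚ (lengthPart D deg 0) = 1 := by
  rw [finrank_lengthPart D hdeg hfin, Finset.card_eq_one]
  refine ⟨[], ?_⟩
  ext w
  rw [Set.Finite.mem_toFinset, Set.mem_ofPred_eq, Finset.mem_singleton]
  rcases w with _ | ⟨a, w⟩
  · simp [wordLength_nil]
  · have := hdeg a
    simp only [wordLength_cons, reduceCtorEq, iff_false]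
    omega

theorem logDerivCoeff_eq (D : LetterProduct Z) {deg : Z → ℕ} (hdeg : ∀ z, 0 < deg z)
    (hfin : ∀ n, {z | deg z = n}.Finite) (n : ℕ) :
    logDerivCoeff D deg n =
      ∑ d ∈ n.divisors, (d : ℚ) * ((lyndonWords (Z := Z) deg d).ncard : ℚ) := by
  set F := poincareSeries D deg with hF
  have hF0 : PowerSeries.constantCoeff F = 1 := by
    rw [← PowerSeries.coeff_zero_eq_constantCoeff_apply, hF, poincareSeries, PowerSeries.coeff_mk,
      finrank_lengthPart_zero D hdeg hfin, Nat.cast_one]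
  let C : PowerSeries ℚ := PowerSeries.mk fun n =>
    ∑ d ∈ n.divisors, (d : ℚ) * ((lyndonWords (Z := Z) deg d).ncard : ℚ)
  have hC : C * F = PowerSeries.X * PowerSeries.derivative ℚ F := by
    ext n
    have hR : PowerSeries.coeff n (PowerSeries.X * PowerSeries.derivative ℚ F) =
        n * (Module.finrank ℚ (lengthPart D deg n) : ℚ) := by
      rcases n with _ | n
      · simp
      · rw [PowerSeries.coeff_succ_X_mul, PowerSeries.coeff_derivative, hF, poincareSeries,
          PowerSeries.coeff_mk]
        push_cast
        ring
    -- The Cauchy product also has a term `k = 0`; it vanishes because `Nat.divisors 0` is empty.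
    rw [hR, ← Nat.cast_mul, mul_finrank_lengthPart D hdeg hfin, PowerSeries.coeff_mul,
      Finset.Nat.sum_antidiagonal_eq_sum_range_succ_mk, Finset.range_eq_Ico,
      Finset.sum_eq_sum_Ico_succ_bot (Nat.succ_pos n)]
    simp [C, hF, poincareSeries, Finset.Ico_add_one_right_eq_Icc]
  have hne : F ≠ 0 := by
    rintro h
    simp [h] at hF0
  -- Both sides become `X F'` after multiplication by `F`, which is nonzero.
  have hlog : PowerSeries.X * PowerSeries.derivative ℚ (PowerSeries.logOf F) = C :=
    mul_right_cancel₀ hne (by rw [hC, mul_assoc, derivative_logOf_mul hF0])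
  rw [logDerivCoeff, hlog, PowerSeries.coeff_mk]

theorem ncard_lyndonWords (D : LetterProduct Z) {deg : Z → ℕ} (hdeg : ∀ z, 0 < deg z)
    (hfin : ∀ n, {z | deg z = n}.Finite) {n : ℕ} (hn : 1 ≤ n) :
    ((lyndonWords (Z := Z) deg n).ncard : ℚ) =
      (1 / (n : ℚ)) * ∑ d ∈ n.divisors,
        (ArithmeticFunction.moebius (n / d) : ℚ) * logDerivCoeff D deg d := by
  have h := (ArithmeticFunction.sum_eq_iff_sum_mul_moebius_eq
    (f := fun d => (d : ℚ) * ((lyndonWords (Z := Z) deg d).ncard : ℚ))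
    (g := logDerivCoeff D deg)).1 (fun n _ => (logDerivCoeff_eq D hdeg hfin n).symm) n hn
  rw [Nat.sum_divisorsAntidiagonal'
    (f := fun a b => (ArithmeticFunction.moebius a : ℚ) * logDerivCoeff D deg b)] at h
  have hn0 : (n : ℚ) ≠ 0 := by positivity
  rw [h]
  field_simp

end Counting

end GenQuasiShuffle

end

theorem mainTheorem3 {Z : Type*} [LinearOrder Z] (D : GenQuasiShuffle.LetterProduct Z)
    (deg : Z → ℕ) (hdeg : ∀ z, 0 < deg z) (hfin : ∀ n, {z | deg z = n}.Finite) :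
    -- the Lyndon words are free polynomial generators of `(ℚ⟨Z⟩, ⋆)`
    Function.Bijective
      (MvPolynomial.aeval (fun w : {w : List Z // GenQuasiShuffle.IsLyndon w} =>
          GenQuasiShuffle.word D w.1) :
        MvPolynomial {w : List Z // GenQuasiShuffle.IsLyndon w} ℚ →ₐ[ℚ]
          GenQuasiShuffle.StarAlg D) ∧
    -- the Poincaré series is well defined
    (∀ n, Module.Finite ℚ (GenQuasiShuffle.lengthPart D deg n)) ∧
    -- the number of these generators in each length
    ∀ n, 1 ≤ n →
      (GenQuasiShuffle.lyndonWords (Z := Z) deg n).Finite ∧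
      ((GenQuasiShuffle.lyndonWords (Z := Z) deg n).ncard : ℚ) =
        (1 / (n : ℚ)) * ∑ d ∈ n.divisors,
          (ArithmeticFunction.moebius (n / d) : ℚ) *
            GenQuasiShuffle.logDerivCoeff D deg d :=
  ⟨GenQuasiShuffle.lyndonEval_bijective D,
    fun n => Module.Finite.span_of_finite ℚ
      ((GenQuasiShuffle.finite_wordLength_eq hdeg hfin n).image _),
    fun n hn => ⟨GenQuasiShuffle.finite_lyndonWords hdeg hfin n,
      GenQuasiShuffle.ncard_lyndonWords D hdeg hfin hn⟩⟩
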